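/- **Conventions.** A non-commutative probability space is a complex unital $*$-algebra $\mathcal A$ with a linear form $\varphi$ such that $\varphi(1)=1$, $\varphi(x^*)=\overline{\varphi(x)}$ and $\varphi(xx^*)\ge 0$ for all $x\in\mathcal A$. The distribution of a family $(x_i)_{i\in I}$ of elements is the map $P\mapsto\varphi(P((x_i)_{i\in I}))$ on polynomials in non-commuting variables indexed by $I$. *The family $(M_r(1))$.* Let $\mathcal S$ be the group of finitely supported permutations of $\{0,1,2,\dots\}$ and $\phi$ the trace $\phi(\sum_\sigma x_\sigma\sigma)=x_{\mathrm{id}}$ on $\mathbb C[\mathcal S]$. For $r\ge 0$, $n\ge1$, $t\ge 0$ let $$M_r(n,t)=n^{-r/2}\sum (0\,a_1\,a_2\cdots a_r)\in\mathbb C[\mathcal S],$$ the sum running over the $r$-tuples of pairwise distinct integers of $[1,nt]$ (so $M_0(n,t)=\mathrm{id}$). The families $(M_r(n,t))_{r,t}$ converge in distribution, as $n\to\infty$, to a family $(M_r(t))_{r\ge 0,\,t\ge 0}$ such that $(M_1(t))_{t\ge0}$ is a free Brownian motion (its increments are free and $M_1(t)$ is semi-circular with variance $t$) and $M_r(t)=t^{r/2}U_r(t^{-1/2}M_1(t))$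 for $t>0$, where $U_0=1$, $U_1=X$, $U_{r+1}=XU_r-U_{r-1}$ are the Chebyshev polynomials of the second kind on $[-2,2]$. *The Toeplitz operators.* Let $S$ be the shift $Se_i=e_{i+1}$ on $\ell^2(\mathbb N)$, with orthonormal basis $(e_i)_{i\ge0}$, let $\mathcal T$ be the Toeplitz algebra (the closed unital $*$-algebra of bounded operators generated by $S$), let $\omega(T)=\langle e_0,Te_0\rangle$ be its vacuum state, and for $r\ge0$ put $$T_r=\sum_{k=0}^{r}S^{r-k}S^{*k}.$$ **Proposition (Toeplitz model).** $(\mathcal T,\omega)$ is a non-commutative probability space, the $T_r$ are self-adjoint, and the families $(T_r)_{r\ge0}$ in $(\mathcal T,\omega)$ and $(M_r(1))_{r\ge0}$ have the same distribution. That is: 1. for every polynomial $P$ in the non-commuting variables $(X_r)_{r\ge0}$, $$\lim_{n\to\infty}\phi\big(P((M_r(n,1))_{r\ge0})\big)=\omega\big(P((T_r)_{r\ge0})\big);$$ 2. for every non-commutative probability space $(\mathcal A,\varphi)$ and every family $(M_r(t))_{r\ge0,\,t\ge0}$ in $\mathcal A$ such that $(M_1(t))_{t\ge0}$ is a free Brownian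 motion and $M_r(t)=t^{r/2}U_r(t^{-1/2}M_1(t))$ for all $r\ge 0$, $t>0$, and for every such $P$, $$\varphi\big(P((M_r(1))_{r\ge0})\big)=\omega\big(P((T_r)_{r\ge0})\big).$$ -/

import Mathlib

open scoped NNReal ComplexOrder

noncomputable section

namespace ToeplitzModel

/-! ### Non-commutative probability spaces and non-commutative distributions -/

section Probability

variable {A : Type*} [Ring A] [StarRing A] [Algebra ℂ A] [StarModule ℂ A]

/-- `(A, φ)` is a non-commutative probability space: the linear form `φ` on the complex unital
`*`-algebra `A` is unital, hermitian and positive. -/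
structure IsNCProbabilitySpace (φ : A →ₗ[ℂ] ℂ) : Prop where
  map_one : φ 1 = 1
  map_star : ∀ x, φ (star x) = star (φ x)
  nonneg : ∀ x, 0 ≤ φ (x * star x)

/-- The element `x` is semi-circular with variance `v`: it is self-adjoint and has the moments of
the image under `y ↦ √v y` of the standard semi-circular law `(2π)⁻¹ √(4 - y²) dy` on `[-2, 2]`
(which is the Dirac mass at `0` when `v = 0`). -/
def IsSemicircular (φ : A →ₗ[ℂ] ℂ) (x : A) (v : ℝ≥0) : Prop :=
  IsSelfAdjoint x ∧ ∀ k : ℕ, φ (x ^ k) =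
    ((∫ y in (-2 : ℝ)..2, (Real.sqrt v * y) ^ k * (Real.sqrt (4 - y ^ 2) / (2 * Real.pi)) : ℝ) : ℂ)

/-- The family `x` is free: an alternating product of centred elements, each taken in the unital
`*`-algebra generated by one of the `x i`, is centred. -/
def IsFree {ι : Type*} (φ : A →ₗ[ℂ] ℂ) (x : ι → A) : Prop :=
  ∀ l : List (ι × A), l ≠ [] →
    (∀ p ∈ l, p.2 ∈ StarAlgebra.adjoin ℂ {x p.1} ∧ φ p.2 = 0) →
    l.IsChain (fun p q => p.1 ≠ q.1) →
    φ (l.map Prod.snd).prod = 0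

/-- A free Brownian motion: free increments, and `B t` is semi-circular with variance `t`. -/
structure IsFreeBrownianMotion (φ : A →ₗ[ℂ] ℂ) (B : ℝ≥0 → A) : Prop where
  semicircular : ∀ t, IsSemicircular φ (B t) t
  free_increments : ∀ (p : ℕ) (t : Fin (p + 1) → ℝ≥0), StrictMono t →
    IsFree φ (fun i : Fin p => B (t i.succ) - B (t i.castSucc))

end Probability

/-- The non-commutative distribution of the family `x`: it maps a polynomial `P` in the
non-commutative variables indexed by `I` to `φ (P(x))`. -/
def ncDistribution {A I : Type*} [Ring A] [Algebra ℂ A] (φ : A →ₗ[ℂ] ℂ) (x : I → A) :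
    FreeAlgebra ℂ I →ₗ[ℂ] ℂ :=
  φ ∘ₗ (FreeAlgebra.lift ℂ x).toLinearMap

/-! ### The permutation model -/

/-- The group of finitely supported permutations of the nonnegative integers. -/
def finPerm : Subgroup (Equiv.Perm ℕ) where
  carrier := {σ | {x | σ x ≠ x}.Finite}
  one_mem' := by simp
  mul_mem' := by
    intro σ τ hσ hτ
    refine (Set.Finite.union hσ hτ).subset fun x hx => ?_
    by_contra h
    simp only [Set.mem_union, Set.mem_ofPred_eq, not_or, not_not] at h
    exact hx (by rw [Equiv.Perm.mul_apply, h.2, h.1])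
  inv_mem' := by
    intro σ hσ
    refine Set.Finite.subset hσ fun x hx h => hx ?_
    rw [Equiv.Perm.inv_eq_iff_eq]
    exact h.symm

theorem formPerm_mem_finPerm (l : List ℕ) : l.formPerm ∈ finPerm := by
  refine (List.finite_toSet l).subset fun x hx => ?_
  by_contra h
  exact hx (List.formPerm_apply_of_notMem h)

/-- The cycle `0 → a 0 → a 1 → ⋯ → a (r - 1) → 0` (for pairwise distinct positive `a i`). -/
def cycle {r : ℕ} (a : Fin r → ℕ) : finPerm :=
  ⟨(0 :: List.ofFn a).formPerm, formPerm_mem_finPerm _⟩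

/-- The canonical trace on the group algebra: the coefficient of the identity. -/
def groupTrace : MonoidAlgebra ℂ finPerm →ₗ[ℂ] ℂ where
  toFun x := x.coeff 1
  map_add' _ _ := by simp
  map_smul' _ _ := by simp

/-- `M_r(n, t) = n^{-r/2} ∑ (0 a₁ ⋯ a_r)`, the sum running over the `r`-tuples of pairwise distinct
integers of `[1, n t]`. -/
def permModel (r n : ℕ) (t : ℝ≥0) : MonoidAlgebra ℂ finPerm :=
  (((n : ℝ) ^ (-(r : ℝ) / 2) : ℝ) : ℂ) •
    ∑ a : Fin r ↪ Finset.Icc 1 ⌊(n : ℝ≥0) * t⌋₊,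
      MonoidAlgebra.of ℂ finPerm (cycle fun i => (a i : ℕ))

/-! ### The Toeplitz model -/

/-- The Hilbert space `ℓ²(ℕ)`. -/
abbrev EllTwo : Type := lp (fun _ : ℕ => ℂ) 2

/-- The right shift of a sequence. -/
def shiftFun (x : ℕ → ℂ) : ℕ → ℂ
  | 0 => 0
  | n + 1 => x n

theorem hasSum_shiftFun (x : EllTwo) :
    HasSum (fun i => ‖shiftFun x i‖ ^ (2 : ENNReal).toReal) (‖x‖ ^ (2 : ENNReal).toReal) := by
  rw [← hasSum_nat_add_iff' 1]
  simpa [shiftFun] using lp.hasSum_norm (p := 2) (by norm_num) x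

/-- The shift, as an isometry: `(S x) 0 = 0` and `(S x) (n + 1) = x n`. -/
def shiftIsometry : EllTwo →ₗᵢ[ℂ] EllTwo where
  toFun x := ⟨shiftFun x, memℓp_gen (hasSum_shiftFun x).summable⟩
  map_add' x y := by
    ext i
    cases i with
    | zero => exact (add_zero (0 : ℂ)).symm
    | succ n => rfl
  map_smul' c x := by
    ext i
    cases i <;> simp [shiftFun]
  norm_map' x := by
    have h := lp.norm_rpow_eq_tsum (p := 2) (by norm_num)
      (⟨shiftFun x, memℓp_gen (hasSum_shiftFun x).summable⟩ : EllTwo)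
    have h2 := (hasSum_shiftFun x).tsum_eq
    exact (Real.rpow_left_inj (norm_nonneg _) (norm_nonneg _) (by norm_num)).1 (h.trans h2)

/-- The shift operator on `ℓ²(ℕ)`. -/
def shiftOp : EllTwo →L[ℂ] EllTwo := shiftIsometry.toContinuousLinearMap

/-- The Toeplitz algebra: the closed unital `*`-algebra of operators generated by the shift. -/
def toeplitzAlgebra : StarSubalgebra ℂ (EllTwo →L[ℂ] EllTwo) :=
  StarAlgebra.elemental ℂ shiftOp

/-- The shift as an element of the Toeplitz algebra. -/
def shift : toeplitzAlgebra := ⟨shiftOp, StarAlgebra.elemental.self_mem ℂ shiftOp⟩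

/-- The first vector `e₀` of the canonical basis of `ℓ²(ℕ)`. -/
def e₀ : EllTwo := lp.single 2 0 1

/-- The vacuum state `ω(T) = ⟨e₀, T e₀⟩`. -/
def vacuumState : toeplitzAlgebra →ₗ[ℂ] ℂ where
  toFun T := inner ℂ e₀ ((T : EllTwo →L[ℂ] EllTwo) e₀)
  map_add' _ _ := by simp
  map_smul' _ _ := by simp

/-- `T_r = ∑_{k=0}^r S^{r-k} S*^k`. -/
def toeplitz (r : ℕ) : toeplitzAlgebra :=
  ∑ k ∈ Finset.range (r + 1), shift ^ (r - k) * star shift ^ k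

end ToeplitzModel

end

/-!
A family with `x 0 = 1` and `x (r + 1) * x 1 = x (r + 2) + x r` is given by `x r = U_r (x 1)`, and
the `U_r` form a basis of the polynomials, so a linear form on `P((x_r)_r)` is determined by its
values on the `x r`. The operators `T_r` satisfy this recurrence because `S* S = 1`. The sums
`M_r(n, 1)` satisfy it up to an error of size `n^{-1/2}`: in `(0 a₁ ⋯ a_{r+1}) (0 b)` either `b` is
new, which gives `M_{r+2}`; or `b = a₁`, which cancels `a₁` and gives `M_r`; or `b = a_j` with
`j ≥ 2`, which leaves one summation variable too few for the normalization. Such errors are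
negligible in every polynomial, because a product of permutations labelled by `R` integers can be
the identity only if every label occurs twice, so the trace of a sum over such labels is
`O(n^{R/2})`. In the three models the value on the `r`-th element is `1` for `r = 0` and `0`
otherwise; for the semi-circular law this is the orthogonality of `U_r` to `U_0`.
-/

noncomputable section

namespace ToeplitzModel

open Polynomial Filter Topology Asymptotics

section Chebyshev

variable {R : Type*} [CommRing R]

theorem monic_S_and_natDegree_S [Nontrivial R] (r : ℕ) :
    (Chebyshev.S R r).Monic ∧ (Chebyshev.S R r).natDegree = r := by
  induction r using Nat.twoStepInduction with
  | zero => simp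
  | one => simp [monic_X]
  | more r ih₀ ih₁ =>
    have hX : (X * Chebyshev.S R (r + 1 : ℕ)).natDegree = r + 2 := by
      rw [natDegree_X_mul ih₁.1.ne_zero, ih₁.2]
    have hlt : (Chebyshev.S R r).natDegree < (X * Chebyshev.S R (r + 1 : ℕ)).natDegree := by
      omega
    have hS : Chebyshev.S R (r + 2 : ℕ) = X * Chebyshev.S R (r + 1 : ℕ) - Chebyshev.S R r :=
      mod_cast Chebyshev.S_add_two R r
    rw [hS, natDegree_sub_eq_left_of_natDegree_lt hlt]
    exact ⟨(monic_X.mul ih₁.1).sub_of_left (degree_lt_degree hlt), hX⟩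

theorem span_range_S : Submodule.span R (Set.range fun r : ℕ => Chebyshev.S R r) = ⊤ := by
  nontriviality R
  let s : Polynomial.Sequence R :=
    { elems' := fun r => Chebyshev.S R r
      degree_eq' := fun r => by
        rw [degree_eq_natDegree (monic_S_and_natDegree_S r).1.ne_zero,
          (monic_S_and_natDegree_S r).2] }
  exact s.span fun r => (monic_S_and_natDegree_S (R := R) r).1.leadingCoeff ▸ isUnit_one

variable {A : Type*} [Ring A] [Algebra R A] {x : ℕ → A}

theorem eq_aeval_S_of_recurrence (h0 : x 0 = 1)
    (hrec : ∀ r, x (r + 1) * x 1 = x (r + 2) + x r) (r : ℕ) :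
    x r = aeval (x 1) (Chebyshev.S R r) := by
  induction r using Nat.twoStepInduction with
  | zero => simp [h0]
  | one => simp
  | more r ih₀ ih₁ =>
    have hS : Chebyshev.S R (r + 2 : ℕ) = Chebyshev.S R (r + 1 : ℕ) * X - Chebyshev.S R r := by
      rw [mul_comm]
      exact mod_cast Chebyshev.S_add_two R r
    rw [hS, map_sub, map_mul, aeval_X, ← ih₀, ← ih₁, hrec, add_sub_cancel_right]

/-- The substitution `P ↦ P((U_r)_r)`, where `U_r` is Mathlib's `Chebyshev.S`. -/
def chebyshevSubst : FreeAlgebra R ℕ →ₐ[R] R[X] :=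
  FreeAlgebra.lift R fun r : ℕ => Chebyshev.S R r

theorem lift_eq_aeval_chebyshevSubst {a : A} (hx : ∀ r : ℕ, x r = aeval a (Chebyshev.S R r))
    (P : FreeAlgebra R ℕ) : FreeAlgebra.lift R x P = aeval a (chebyshevSubst P) := by
  have h : FreeAlgebra.lift R x = (aeval a).comp chebyshevSubst := by
    ext r
    simp [chebyshevSubst, hx]
  exact DFunLike.congr_fun h P

theorem lift_sub_aeval_chebyshevSubst_mem (I : TwoSidedIdeal A) (h0 : x 0 = 1)
    (hrec : ∀ r, x (r + 1) * x 1 - (x (r + 2) + x r) ∈ I) (P : FreeAlgebra R ℕ) :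
    FreeAlgebra.lift R x P - aeval (x 1) (chebyshevSubst P) ∈ I := by
  let π : A →ₐ[R] I.ringCon.Quotient := I.ringCon.mkₐ R
  have hπ {a b : A} : π a = π b ↔ a - b ∈ I := (RingCon.eq _).trans (I.rel_iff a b)
  have hx := eq_aeval_S_of_recurrence (R := R) (x := fun r => π (x r)) (by simp [h0]) fun r => by
    rw [← map_mul, ← map_add]
    exact hπ.2 (hrec r)
  have hlift : π.comp (FreeAlgebra.lift R x) = FreeAlgebra.lift R fun r => π (x r) := by
    ext r
    simp
  rw [← hπ, ← aeval_algHom_apply, ← lift_eq_aeval_chebyshevSubst hx, ← hlift, AlgHom.comp_apply]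

end Chebyshev

section Distribution

variable {A B : Type*} [Ring A] [Algebra ℂ A] [Ring B] [Algebra ℂ B] {φ : A →ₗ[ℂ] ℂ}
  {ψ : B →ₗ[ℂ] ℂ} {x : ℕ → A} {y : ℕ → B} {a : A} {b : B}

theorem ncDistribution_eq_of_eq_aeval_S (hx : ∀ r : ℕ, x r = aeval a (Chebyshev.S ℂ r))
    (hy : ∀ r : ℕ, y r = aeval b (Chebyshev.S ℂ r)) (h : ∀ r, φ (x r) = ψ (y r)) :
    ncDistribution φ x = ncDistribution ψ y := by
  have hφψ : φ ∘ₗ (aeval a).toLinearMap = ψ ∘ₗ (aeval b).toLinearMap :=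
    LinearMap.ext_on_range span_range_S fun r => by simpa [← hx, ← hy] using h r
  ext P
  simpa [ncDistribution, lift_eq_aeval_chebyshevSubst hx, lift_eq_aeval_chebyshevSubst hy]
    using DFunLike.congr_fun hφψ (chebyshevSubst P)

theorem tendsto_ncDistribution_of_recurrence {ι : Type*} {l : Filter ι} {φ : ι → A →ₗ[ℂ] ℂ}
    {I : TwoSidedIdeal A} (hI : ∀ z ∈ I, Tendsto (fun i => φ i z) l (𝓝 0)) (h0 : x 0 = 1)
    (hrec : ∀ r, x (r + 1) * x 1 - (x (r + 2) + x r) ∈ I)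
    (hy : ∀ r : ℕ, y r = aeval b (Chebyshev.S ℂ r))
    (h : ∀ r, Tendsto (fun i => φ i (x r)) l (𝓝 (ψ (y r)))) (P : FreeAlgebra ℂ ℕ) :
    Tendsto (fun i => ncDistribution (φ i) x P) l (𝓝 (ncDistribution ψ y P)) := by
  have of_sub_mem {z w : A} {c : ℂ} (hzw : z - w ∈ I) (hw : Tendsto (fun i => φ i w) l (𝓝 c)) :
      Tendsto (fun i => φ i z) l (𝓝 c) := by simpa using (hI _ hzw).add hw
  have tendsto_aeval (p : ℂ[X]) :
      Tendsto (fun i => φ i (aeval (x 1) p)) l (𝓝 (ψ (aeval b p))) := by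
    have hp : p ∈ Submodule.span ℂ (Set.range fun r : ℕ => Chebyshev.S ℂ r) := by
      rw [span_range_S]
      exact Submodule.mem_top
    induction hp using Submodule.span_induction with
    | mem p hp =>
      obtain ⟨r, rfl⟩ := hp
      have hr : aeval (x 1) (Chebyshev.S ℂ r) - x r ∈ I := by
        simpa [chebyshevSubst] using
          I.neg_mem (lift_sub_aeval_chebyshevSubst_mem I h0 hrec (FreeAlgebra.ι ℂ r))
      exact of_sub_mem hr (hy r ▸ h r)
    | zero => simpa using tendsto_const_nhds
    | add p q _ _ hp hq => simpa only [map_add] using hp.add hq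
    | smul c p _ hp => simpa only [map_smul] using hp.const_smul c
  simpa [ncDistribution, lift_eq_aeval_chebyshevSubst hy] using
    of_sub_mem (lift_sub_aeval_chebyshevSubst_mem I h0 hrec P) (tendsto_aeval (chebyshevSubst P))

end Distribution

section Toeplitz

theorem star_shift_mul_shift : star shift * shift = 1 := by
  refine Subtype.ext (ContinuousLinearMap.ext fun x => ext_inner_left ℂ fun y => ?_)
  change inner ℂ y (ContinuousLinearMap.adjoint shiftOp (shiftOp x)) = inner ℂ y x
  rw [ContinuousLinearMap.adjoint_inner_right]
  exact shiftIsometry.inner_map_map y x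

theorem star_shiftOp_e₀ : star shiftOp e₀ = 0 := by
  refine ext_inner_right ℂ fun y => ?_
  rw [ContinuousLinearMap.star_eq_adjoint, ContinuousLinearMap.adjoint_inner_left,
    inner_zero_left, e₀, lp.inner_single_left]
  exact inner_zero_right _

theorem isNCProbabilitySpace_vacuumState : IsNCProbabilitySpace vacuumState where
  map_one := by
    change inner ℂ e₀ e₀ = 1
    simp [e₀]
  map_star T := by
    change inner ℂ e₀ (ContinuousLinearMap.adjoint (T : EllTwo →L[ℂ] EllTwo) e₀) = _
    rw [ContinuousLinearMap.adjoint_inner_right]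
    exact (inner_conj_symm _ _).symm
  nonneg T := by
    change 0 ≤ inner ℂ e₀ ((T : EllTwo →L[ℂ] EllTwo)
      (ContinuousLinearMap.adjoint (T : EllTwo →L[ℂ] EllTwo) e₀))
    rw [← ContinuousLinearMap.adjoint_inner_left, inner_self_eq_norm_sq_to_K,
      ← RCLike.ofReal_pow]
    exact Complex.zero_le_real.2 (sq_nonneg _)

theorem isSelfAdjoint_toeplitz (r : ℕ) : IsSelfAdjoint (toeplitz r) := by
  rw [IsSelfAdjoint, toeplitz, star_sum, ← Finset.sum_range_reflect]
  refine Finset.sum_congr rfl fun k hk => ?_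
  have hkr : k ≤ r := Nat.lt_succ_iff.1 (Finset.mem_range.1 hk)
  simp [star_mul, star_pow, Nat.sub_sub_self hkr]

theorem toeplitz_zero : toeplitz 0 = 1 := by simp [toeplitz]

theorem toeplitz_one : toeplitz 1 = shift + star shift := by
  simp [toeplitz, Finset.sum_range_succ]

theorem toeplitz_succ (r : ℕ) :
    toeplitz (r + 1) = toeplitz r * star shift + shift ^ (r + 1) := by
  simp only [toeplitz, Finset.sum_range_succ' _ (r + 1), Finset.sum_mul, mul_assoc, pow_succ,
    Nat.add_sub_add_right, tsub_zero, pow_zero, mul_one]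

theorem toeplitz_succ_mul_toeplitz_one (r : ℕ) :
    toeplitz (r + 1) * toeplitz 1 = toeplitz (r + 2) + toeplitz r :=
  calc toeplitz (r + 1) * toeplitz 1
      = toeplitz (r + 1) * star shift + (toeplitz r * star shift + shift ^ (r + 1)) * shift := by
        rw [toeplitz_one, mul_add, add_comm, ← toeplitz_succ]
    _ = toeplitz (r + 1) * star shift + shift ^ (r + 2) + toeplitz r := by
        rw [add_mul, mul_assoc, star_shift_mul_shift, mul_one, ← pow_succ]
        abel
    _ = toeplitz (r + 2) + toeplitz r := by rw [← toeplitz_succ]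

theorem toeplitz_eq_aeval_S (r : ℕ) : toeplitz r = aeval (toeplitz 1) (Chebyshev.S ℂ r) :=
  eq_aeval_S_of_recurrence toeplitz_zero toeplitz_succ_mul_toeplitz_one r

theorem vacuumState_toeplitz (r : ℕ) : vacuumState (toeplitz r) = if r = 0 then 1 else 0 := by
  cases r with
  | zero => simpa [toeplitz_zero] using isNCProbabilitySpace_vacuumState.map_one
  | succ r =>
    have h₁ : vacuumState (toeplitz r * star shift) = 0 := by
      change inner ℂ e₀ ((toeplitz r : EllTwo →L[ℂ] EllTwo) (star shiftOp e₀)) = 0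
      rw [star_shiftOp_e₀, map_zero, inner_zero_right]
    have h₂ : vacuumState (shift ^ (r + 1)) = 0 := by
      rw [pow_succ']
      change inner ℂ e₀ (shiftOp ((shiftOp ^ r) e₀)) = 0
      rw [← ContinuousLinearMap.adjoint_inner_left, ← ContinuousLinearMap.star_eq_adjoint,
        star_shiftOp_e₀, inner_zero_left]
    rw [toeplitz_succ, map_add, h₁, h₂, add_zero, if_neg r.succ_ne_zero]

end Toeplitz

section Semicircle

open Real intervalIntegral

theorem sqrt_four_sub_sq_two_mul_cos {θ : ℝ} (hθ : θ ∈ Set.Icc 0 π) :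
    √(4 - (2 * cos θ) ^ 2) = 2 * sin θ := by
  have h : 4 - (2 * cos θ) ^ 2 = (2 * sin θ) ^ 2 := by linarith [sin_sq_add_cos_sq θ]
  rw [h, sqrt_sq (mul_nonneg zero_le_two (sin_nonneg_of_mem_Icc hθ))]

theorem integral_mul_semicircle {f : ℝ → ℝ} (hf : Continuous f) :
    ∫ y in (-2 : ℝ)..2, f y * (√(4 - y ^ 2) / (2 * π)) =
      ∫ θ in (0 : ℝ)..π, f (2 * cos θ) * (2 * sin θ ^ 2 / π) := by
  have hsubst := integral_comp_mul_deriv (a := 0) (b := π)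
    (g := fun y => f y * (√(4 - y ^ 2) / (2 * π)))
    (fun θ _ => (hasDerivAt_cos θ).const_mul 2) (by fun_prop) (by fun_prop)
  simp only [cos_zero, cos_pi, mul_neg, mul_one, integral_neg, Function.comp_apply] at hsubst
  rw [integral_symm, ← hsubst, neg_neg]
  refine integral_congr fun θ hθ => ?_
  rw [Set.uIcc_of_le pi_pos.le] at hθ
  simp only [sqrt_four_sub_sq_two_mul_cos hθ]
  field_simp

theorem integral_cos_natCast_mul (k : ℕ) :
    ∫ θ in (0 : ℝ)..π, cos (k * θ) = if k = 0 then π else 0 := by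
  split_ifs with hk
  · simp [hk]
  · rw [integral_comp_mul_left _ (Nat.cast_ne_zero.2 hk)]
    simp

theorem eval_S_two_mul_cos_mul_sin_sq (r : ℕ) (θ : ℝ) :
    (Chebyshev.S ℝ r).eval (2 * cos θ) * (2 * sin θ ^ 2) =
      cos (r * θ) - cos ((r + 2 : ℕ) * θ) := by
  have hS : (Chebyshev.S ℝ r).eval (2 * cos θ) * sin θ = sin ((r + 1) * θ) :=
    mod_cast Chebyshev.S_two_mul_real_cos θ r
  have hr : (r : ℝ) * θ = (r + 1) * θ - θ := by ring
  have hr2 : ((r + 2 : ℕ) : ℝ) * θ = (r + 1) * θ + θ := by push_cast; ring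
  rw [hr, hr2, cos_sub, cos_add, ← hS]
  ring

theorem integral_eval_S_mul_semicircle (r : ℕ) :
    ∫ y in (-2 : ℝ)..2, (Chebyshev.S ℝ r).eval y * (√(4 - y ^ 2) / (2 * π)) =
      if r = 0 then 1 else 0 := by
  rw [integral_mul_semicircle (Polynomial.continuous _)]
  simp only [← mul_div_assoc, eval_S_two_mul_cos_mul_sin_sq]
  rw [intervalIntegral.integral_div, integral_sub (Continuous.intervalIntegrable (by fun_prop) _ _)
    (Continuous.intervalIntegrable (by fun_prop) _ _), integral_cos_natCast_mul,
    integral_cos_natCast_mul]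
  split_ifs <;> simp_all [pi_ne_zero]

variable {A : Type*} [Ring A] [StarRing A] [Algebra ℂ A] {φ : A →ₗ[ℂ] ℂ} {x : A}

theorem IsSemicircular.map_aeval {v : ℝ≥0} (hx : IsSemicircular φ x v) (p : ℝ[X]) :
    φ (aeval x (p.map (algebraMap ℝ ℂ))) =
      ((∫ y in (-2 : ℝ)..2, p.eval (√v * y) * (√(4 - y ^ 2) / (2 * π)) : ℝ) : ℂ) := by
  induction p using Polynomial.induction_on' with
  | add p q hp hq =>
    simp only [Polynomial.map_add, map_add, hp, hq, ← Complex.ofReal_add, eval_add, add_mul]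
    rw [integral_add] <;> exact Continuous.intervalIntegrable (by fun_prop) _ _
  | monomial k c => simp [aeval_monomial, ← Algebra.smul_def, hx.2 k, mul_assoc]

theorem IsSemicircular.map_aeval_S (hx : IsSemicircular φ x 1) (r : ℕ) :
    φ (aeval x (Chebyshev.S ℂ r)) = if r = 0 then 1 else 0 := by
  rw [← Chebyshev.map_S (algebraMap ℝ ℂ), hx.map_aeval]
  simp only [NNReal.coe_one, sqrt_one, one_mul, integral_eval_S_mul_semicircle]
  split_ifs <;> simp

end Semicircle

section Labelling

variable {ι κ α : Type*} {s : Finset α}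

/-- The permutation `σ` is labelled by the family `a` of points of `s`: among the points of `s`, it
fixes those outside the range of `a` and moves those that `a` takes exactly once. Nothing is asked
of the points that `a` repeats, which makes the notion stable under products. -/
structure IsLabelledBy (σ : Equiv.Perm α) (a : ι → s) : Prop where
  apply_eq_self : ∀ v : s, v ∉ Set.range a → σ v = v
  apply_ne_self : ∀ i, (∀ j ≠ i, a j ≠ a i) → σ (a i) ≠ a i

theorem isLabelledBy_of_apply_ne_iff {σ : Equiv.Perm α} {a : ι → s}
    (h : ∀ v : s, σ v ≠ v ↔ v ∈ Set.range a) : IsLabelledBy σ a where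
  apply_eq_self v hv := not_not.1 (mt (h v).1 hv)
  apply_ne_self i _ := (h (a i)).2 ⟨i, rfl⟩

theorem IsLabelledBy.mul {σ τ : Equiv.Perm α} {R R' : ℕ} {a : Fin R → s} {b : Fin R' → s}
    (hσ : IsLabelledBy σ a) (hτ : IsLabelledBy τ b) : IsLabelledBy (σ * τ) (Fin.append a b) where
  apply_eq_self v hv := by
    have ha : v ∉ Set.range a := fun ⟨i, hi⟩ => hv ⟨Fin.castAdd R' i, by simpa using hi⟩
    have hb : v ∉ Set.range b := fun ⟨i, hi⟩ => hv ⟨Fin.natAdd R i, by simpa using hi⟩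
    rw [Equiv.Perm.mul_apply, hτ.apply_eq_self v hb, hσ.apply_eq_self v ha]
  apply_ne_self k hk := by
    have hne (i : Fin R) (j : Fin R') : Fin.castAdd R' i ≠ Fin.natAdd R j := fun h => by
      have := congrArg Fin.val h
      simp only [Fin.val_castAdd, Fin.val_natAdd] at this
      lia
    rw [Equiv.Perm.mul_apply]
    induction k using Fin.addCases with
    | left i =>
      simp only [Fin.append_left] at hk ⊢
      have hb : a i ∉ Set.range b := fun ⟨j, hj⟩ => hk _ (hne i j).symm (by simpa using hj)
      have ha (j : Fin R) (hj : j ≠ i) : a j ≠ a i := by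
        simpa using hk (Fin.castAdd R' j) (by simpa using hj)
      rw [hτ.apply_eq_self _ hb]
      exact hσ.apply_ne_self i ha
    | right i =>
      simp only [Fin.append_right] at hk ⊢
      have ha : b i ∉ Set.range a := fun ⟨j, hj⟩ => hk _ (hne j i) (by simpa using hj)
      have hb (j : Fin R') (hj : j ≠ i) : b j ≠ b i := by
        simpa using hk (Fin.natAdd R j) (by simpa using hj)
      nth_rw 2 [← hσ.apply_eq_self _ ha]
      exact σ.injective.ne (hτ.apply_ne_self i hb)

theorem IsLabelledBy.exists_ne_eq {a : ι → s} (h : IsLabelledBy 1 a) (i : ι) :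
    ∃ j ≠ i, a j = a i := by
  by_contra! hi
  exact h.apply_ne_self i hi rfl

theorem two_mul_card_image_le [Fintype ι] [DecidableEq κ] {a : ι → κ}
    (h : ∀ i, ∃ j ≠ i, a j = a i) : 2 * (Finset.univ.image a).card ≤ Fintype.card ι := by
  refine Finset.mul_card_image_le_card _ 2 fun v hv => Finset.one_lt_card.2 ?_
  obtain ⟨i, -, rfl⟩ := Finset.mem_image.1 hv
  obtain ⟨j, hji, hj⟩ := h i
  exact ⟨j, by simpa using hj, i, by simp, hji⟩

theorem card_filter_card_image_le [Fintype ι] [DecidableEq ι] [Fintype κ] [DecidableEq κ]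
    [Nonempty κ] (m : ℕ) :
    (Finset.univ.filter fun a : ι → κ => (Finset.univ.image a).card ≤ m).card ≤
      m ^ Fintype.card ι * Fintype.card κ ^ m := by
  have hsub : (Finset.univ.filter fun a : ι → κ => (Finset.univ.image a).card ≤ m) ⊆
      Finset.univ.image fun p : (ι → Fin m) × (Fin m → κ) => p.2 ∘ p.1 := fun a ha => by
    have hcard : Fintype.card (Finset.univ.image a) ≤ Fintype.card (Fin m) := by
      rw [Fintype.card_coe, Fintype.card_fin]
      exact (Finset.mem_filter.1 ha).2
    obtain ⟨e⟩ := Function.Embedding.nonempty_of_card_le hcard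
    have ha' (i : ι) : a i ∈ Finset.univ.image a := Finset.mem_image_of_mem a (Finset.mem_univ i)
    let f (i : ι) : Fin m := e ⟨a i, ha' i⟩
    let g : Fin m → κ := Function.extend e Subtype.val fun _ => Classical.arbitrary κ
    have hgf : g ∘ f = a := by
      ext i
      exact e.injective.extend_apply Subtype.val (fun _ => Classical.arbitrary κ) ⟨a i, ha' i⟩
    exact Finset.mem_image.2 ⟨(f, g), Finset.mem_univ _, hgf⟩
  calc _ ≤ _ := Finset.card_le_card hsub
    _ ≤ _ := Finset.card_image_le
    _ = m ^ Fintype.card ι * Fintype.card κ ^ m := by simp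

end Labelling

section LabelledSum

theorem groupTrace_of (σ : finPerm) [Decidable (σ = 1)] :
    groupTrace (MonoidAlgebra.of ℂ finPerm σ) = if σ = 1 then 1 else 0 := by
  change (MonoidAlgebra.single σ (1 : ℂ)).coeff 1 = _
  rw [MonoidAlgebra.coeff_single, Finsupp.single_apply]

variable {n R R' : ℕ} {x y : MonoidAlgebra ℂ finPerm}

/-- `x` is a sum of permutations labelled by distinct `R`-tuples of integers of `[1, n]`. -/
def IsLabelledSum (n R : ℕ) (x : MonoidAlgebra ℂ finPerm) : Prop :=
  ∃ (ι : Type) (_ : Fintype ι) (label : ι → Fin R → Finset.Icc 1 n) (σ : ι → finPerm),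
    label.Injective ∧ (∀ i, IsLabelledBy (σ i : Equiv.Perm ℕ) (label i)) ∧
      x = ∑ i, MonoidAlgebra.of ℂ finPerm (σ i)

theorem isLabelledSum_one (n : ℕ) : IsLabelledSum n 0 1 :=
  ⟨Unit, inferInstance, fun _ => Fin.elim0, 1, fun _ _ _ => rfl,
    fun _ => isLabelledBy_of_apply_ne_iff (by simp), by simp [MonoidAlgebra.one_def]⟩

theorem IsLabelledSum.mul (hx : IsLabelledSum n R x) (hy : IsLabelledSum n R' y) :
    IsLabelledSum n (R + R') (x * y) := by
  obtain ⟨ι, _, a, σ, ha, hσ, rfl⟩ := hx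
  obtain ⟨κ, _, b, τ, hb, hτ, rfl⟩ := hy
  refine ⟨ι × κ, inferInstance, fun p => Fin.append (a p.1) (b p.2), fun p => σ p.1 * τ p.2,
    (Fin.appendEquiv R R').injective.comp (ha.prodMap hb), fun p => (hσ p.1).mul (hτ p.2), ?_⟩
  simp only [map_mul, Fintype.sum_mul_sum, Fintype.sum_prod_type]

theorem isLabelledSum_sum_embedding {σ : (Fin R ↪ Finset.Icc 1 n) → finPerm}
    (hσ : ∀ a, IsLabelledBy (σ a : Equiv.Perm ℕ) a) :
    IsLabelledSum n R (∑ a, MonoidAlgebra.of ℂ finPerm (σ a)) :=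
  ⟨_, inferInstance, _, σ, DFunLike.coe_injective, hσ, rfl⟩

theorem IsLabelledSum.norm_groupTrace_le (hx : IsLabelledSum n R x) (hn : n ≠ 0) :
    ‖groupTrace x‖ ≤ (R / 2 : ℕ) ^ R * (n : ℝ) ^ (R / 2) := by
  classical
  obtain ⟨ι, _, a, σ, ha, hσ, rfl⟩ := hx
  have : Nonempty (Finset.Icc 1 n) := ⟨1, Finset.mem_Icc.2 ⟨le_rfl, Nat.one_le_iff_ne_zero.2 hn⟩⟩
  have htrace : groupTrace (∑ i, MonoidAlgebra.of ℂ finPerm (σ i)) =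
      (Finset.univ.filter fun i => σ i = 1).card := by
    simp only [map_sum, groupTrace_of, Finset.sum_boole]
  have himage {i : ι} (hi : σ i = 1) : (Finset.univ.image (a i)).card ≤ R / 2 := by
    have h1 : IsLabelledBy 1 (a i) := by simpa [hi] using hσ i
    have h2 := two_mul_card_image_le h1.exists_ne_eq
    rw [Fintype.card_fin] at h2
    omega
  have hcard : (Finset.univ.filter fun i => σ i = 1).card ≤ (R / 2) ^ R * n ^ (R / 2) :=
    calc _ ≤ (Finset.univ.filter fun b : Fin R → Finset.Icc 1 n =>
          (Finset.univ.image b).card ≤ R / 2).card :=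
        Finset.card_le_card_of_injOn a (fun i hi => by simpa using himage (by simpa using hi))
          ha.injOn
      _ ≤ (R / 2) ^ R * n ^ (R / 2) := by
        simpa using card_filter_card_image_le (ι := Fin R) (κ := Finset.Icc 1 n) (R / 2)
  rw [htrace, Complex.norm_natCast]
  exact mod_cast hcard

end LabelledSum

section Cycle

theorem formPerm_cons_mul_swap {α : Type*} [DecidableEq α] {x b : α} {l : List α}
    (h : (x :: b :: l).Nodup) :
    (x :: l).formPerm * Equiv.swap x b = (x :: b :: l).formPerm :=
  calc (x :: l).formPerm * Equiv.swap x b = (l ++ [x]).formPerm * Equiv.swap x b := by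
        rw [← List.formPerm_rotate (x :: l) (by grind) 1]
        simp
    _ = (l ++ [x, b]).formPerm := (List.formPerm_append_pair l x b).symm
    _ = (x :: b :: l).formPerm := by
        rw [← List.formPerm_rotate (x :: b :: l) h 2]
        simp

theorem nodup_cons_ofFn {r n : ℕ} (a : Fin r ↪ Finset.Icc 1 n) :
    (0 :: List.ofFn fun i => (a i : ℕ)).Nodup := by
  rw [List.nodup_cons, List.nodup_ofFn, List.mem_ofFn]
  refine ⟨?_, Subtype.val_injective.comp a.injective⟩
  rintro ⟨i, hi⟩
  have := (Finset.mem_Icc.1 (a i).2).1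
  omega

/-- The transposition `(0 b)`; these are the terms of the normalized sum `M_1`. -/
def starTransposition (b : ℕ) : finPerm := cycle fun _ : Fin 1 => b

theorem coe_starTransposition (b : ℕ) :
    (starTransposition b : Equiv.Perm ℕ) = Equiv.swap 0 b := by
  simp [starTransposition, cycle]

theorem starTransposition_mul_self (b : ℕ) : starTransposition b * starTransposition b = 1 :=
  Subtype.ext (by simp [coe_starTransposition])

theorem cycle_fin_zero (a : Fin 0 → ℕ) : cycle a = 1 := Subtype.ext (by simp [cycle])

variable {r n : ℕ}

theorem cycle_tail_mul_starTransposition (a : Fin (r + 1) ↪ Finset.Icc 1 n) :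
    (cycle fun i => (a i.succ : ℕ)) * starTransposition (a 0) = cycle fun i => (a i : ℕ) := by
  have h := nodup_cons_ofFn a
  rw [List.ofFn_succ] at h
  refine Subtype.ext ?_
  simp only [Subgroup.coe_mul, coe_starTransposition, cycle, List.ofFn_succ,
    formPerm_cons_mul_swap h]

theorem cycle_mul_starTransposition_head (a : Fin (r + 1) ↪ Finset.Icc 1 n) :
    (cycle fun i => (a i : ℕ)) * starTransposition (a 0) = cycle fun i => (a i.succ : ℕ) := by
  rw [← cycle_tail_mul_starTransposition, mul_assoc, starTransposition_mul_self, mul_one]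

theorem cycle_apply_zero (a : Fin (r + 1) ↪ Finset.Icc 1 n) :
    (cycle fun i => (a i : ℕ) : Equiv.Perm ℕ) 0 = a 0 := by
  have h := nodup_cons_ofFn a
  rw [List.ofFn_succ] at h
  simp only [cycle, List.ofFn_succ, List.formPerm_apply_head _ _ _ h]

theorem cycle_apply_ne_iff (a : Fin r ↪ Finset.Icc 1 n) (v : Finset.Icc 1 n) :
    (cycle fun i => (a i : ℕ) : Equiv.Perm ℕ) v ≠ v ↔ v ∈ Set.range a := by
  have hv : (v : ℕ) ≠ 0 := Nat.one_le_iff_ne_zero.1 (Finset.mem_Icc.1 v.2).1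
  have hmem : (v : ℕ) ∈ 0 :: List.ofFn (fun i => (a i : ℕ)) ↔ v ∈ Set.range a := by
    rw [List.mem_cons, or_iff_right hv, List.mem_ofFn]
    simp only [Set.mem_range, Subtype.ext_iff]
  rw [← hmem]
  refine ⟨fun h => by_contra fun hv' => h (List.formPerm_apply_of_notMem hv'), fun h => ?_⟩
  obtain ⟨i, -⟩ := hmem.1 h
  refine (List.formPerm_apply_mem_ne_self_iff _ (nodup_cons_ofFn a) v h).2 ?_
  simpa [Nat.one_le_iff_ne_zero] using i.pos.ne'

theorem cycle_mul_starTransposition_apply_ne_iff (a : Fin (r + 1) ↪ Finset.Icc 1 n) (j : Fin r)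
    (v : Finset.Icc 1 n) :
    ((cycle fun i => (a i : ℕ)) * starTransposition (a j.succ) : Equiv.Perm ℕ) v ≠ v ↔
      v ∈ Set.range a := by
  rw [coe_starTransposition, Equiv.Perm.mul_apply]
  by_cases hv : v = a j.succ
  · rw [hv, Equiv.swap_apply_right, cycle_apply_zero]
    simp [(Fin.succ_ne_zero j).symm]
  · have hv0 : (v : ℕ) ≠ 0 := Nat.one_le_iff_ne_zero.1 (Finset.mem_Icc.1 v.2).1
    rw [Equiv.swap_apply_of_ne_of_ne hv0 (Subtype.coe_ne_coe.2 hv), cycle_apply_ne_iff]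

end Cycle

section CycleSum

variable {r n : ℕ}

/-- The unnormalized sum `∑ (0 a₁ ⋯ a_r)` over the `r`-tuples of distinct integers of `[1, n]`. -/
def cycleSum (r n : ℕ) : MonoidAlgebra ℂ finPerm :=
  ∑ a : Fin r ↪ Finset.Icc 1 n, MonoidAlgebra.of ℂ finPerm (cycle fun i => (a i : ℕ))

/-- The sum `∑ (0 a₁ ⋯ a_{r+1}) (0 a_j)` over the `(r + 1)`-tuples of distinct integers of `[1, n]`,
for a fixed `j ≥ 2` (so that `j : Fin r` stands for the paper's index `j + 2`). -/
def collisionSum (j : Fin r) (n : ℕ) : MonoidAlgebra ℂ finPerm :=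
  ∑ a : Fin (r + 1) ↪ Finset.Icc 1 n, MonoidAlgebra.of ℂ finPerm
    ((cycle fun i => (a i : ℕ)) * starTransposition (a j.succ))

theorem isLabelledSum_cycleSum (r n : ℕ) : IsLabelledSum n r (cycleSum r n) :=
  isLabelledSum_sum_embedding fun a => isLabelledBy_of_apply_ne_iff (cycle_apply_ne_iff a)

theorem isLabelledSum_collisionSum (j : Fin r) (n : ℕ) :
    IsLabelledSum n (r + 1) (collisionSum j n) :=
  isLabelledSum_sum_embedding fun a =>
    isLabelledBy_of_apply_ne_iff (cycle_mul_starTransposition_apply_ne_iff a j)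

theorem cycleSum_zero (n : ℕ) : cycleSum 0 n = 1 := by
  simp [cycleSum, cycle_fin_zero, MonoidAlgebra.one_def]

theorem cycleSum_one (n : ℕ) :
    cycleSum 1 n = ∑ b : Finset.Icc 1 n, MonoidAlgebra.of ℂ finPerm (starTransposition b) :=
  Fintype.sum_equiv Equiv.uniqueEmbeddingEquivResult _ _ fun a => by
    congr 2

theorem sum_embedding_succ {M : Type*} [AddCommMonoid M] {α : Type*} [Fintype α] [DecidableEq α]
    (f : (Fin r ↪ α) → α → M) :
    ∑ a : Fin (r + 1) ↪ α, f ((Fin.succEmb r).trans a) (a 0) =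
      ∑ a : Fin r ↪ α, ∑ b : {b // b ∉ Set.range a}, f a b := by
  rw [← (Equiv.embeddingFinSucc r α).symm.sum_comp, Fintype.sum_sigma]
  rfl

theorem cycleSum_succ (r n : ℕ) :
    cycleSum (r + 1) n = ∑ a : Fin r ↪ Finset.Icc 1 n, ∑ b : {b // b ∉ Set.range a},
      MonoidAlgebra.of ℂ finPerm ((cycle fun i => (a i : ℕ)) * starTransposition b) := by
  rw [← sum_embedding_succ fun a (b : Finset.Icc 1 n) => MonoidAlgebra.of ℂ finPerm
    ((cycle fun i => (a i : ℕ)) * starTransposition b)]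
  exact Fintype.sum_congr _ _ fun a => congrArg _ (cycle_tail_mul_starTransposition a).symm

theorem sum_cycle_tail (r n : ℕ) :
    ∑ a : Fin (r + 1) ↪ Finset.Icc 1 n,
      MonoidAlgebra.of ℂ finPerm (cycle fun i => (a i.succ : ℕ)) =
        ((n : ℂ) - r) • cycleSum r n := by
  refine (sum_embedding_succ fun (a : Fin r ↪ Finset.Icc 1 n) _ =>
    MonoidAlgebra.of ℂ finPerm (cycle fun i => (a i : ℕ))).trans ?_
  rw [cycleSum, Finset.smul_sum]
  refine Fintype.sum_congr _ _ fun a => ?_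
  have hr : r ≤ n := by simpa using Fintype.card_le_of_embedding a
  have hcard : Fintype.card {b // b ∉ Set.range a} = n - r := by
    rw [Fintype.card_subtype_compl, ← Fintype.card_congr (Equiv.ofInjective a a.injective)]
    simp
  rw [Finset.sum_const, Finset.card_univ, hcard, ← Nat.cast_smul_eq_nsmul ℂ, Nat.cast_sub hr]

theorem sum_eq_sum_notMem_range_add {ι α M : Type*} [Fintype ι] [Fintype α] [DecidableEq α]
    [AddCommMonoid M] (a : ι ↪ α) (f : α → M) :
    ∑ b, f b = ∑ b : {b // b ∉ Set.range a}, f b + ∑ i, f (a i) := by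
  rw [← Fintype.sum_subtype_add_sum_subtype (fun b => b ∉ Set.range a) f]
  congr 1
  exact (Fintype.sum_equiv ((Equiv.ofInjective a a.injective).trans
    (Equiv.subtypeEquivRight fun b => not_not.symm)) _ _ fun i => rfl).symm

theorem cycleSum_succ_mul_cycleSum_one (r n : ℕ) :
    cycleSum (r + 1) n * cycleSum 1 n =
      cycleSum (r + 2) n + ((n : ℂ) - r) • cycleSum r n + ∑ j : Fin r, collisionSum j n := by
  simp only [collisionSum]
  rw [cycleSum_one, cycleSum_succ (r + 1), ← sum_cycle_tail, Finset.sum_comm,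
    ← Finset.sum_add_distrib, ← Finset.sum_add_distrib, cycleSum, Finset.sum_mul_sum]
  refine Fintype.sum_congr _ _ fun a => ?_
  simp only [← map_mul]
  rw [sum_eq_sum_notMem_range_add a, Fin.sum_univ_succ, cycle_mul_starTransposition_head,
    add_assoc]

theorem groupTrace_cycleSum (r n : ℕ) : groupTrace (cycleSum r n) = if r = 0 then 1 else 0 := by
  classical
  cases r with
  | zero => rw [cycleSum_zero, ← map_one (MonoidAlgebra.of ℂ finPerm), groupTrace_of, if_pos rfl,
      if_pos rfl]
  | succ r =>
    have hne (a : Fin (r + 1) ↪ Finset.Icc 1 n) : (cycle fun i => (a i : ℕ)) ≠ 1 := fun h => by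
      have h0 : (a 0 : ℕ) = 0 := by rw [← cycle_apply_zero, h]; rfl
      have := (Finset.mem_Icc.1 (a 0).2).1
      omega
    simp only [cycleSum, map_sum, groupTrace_of, hne, if_false, Finset.sum_const_zero,
      r.succ_ne_zero]

end CycleSum

section Normalization

/-- The normalization `n ^ (-1 / 2)` (equal to `0` when `n = 0`). -/
def invSqrt (n : ℕ) : ℂ := ((√(n : ℝ))⁻¹ : ℝ)

theorem invSqrt_sq_mul {n : ℕ} (hn : n ≠ 0) : invSqrt n ^ 2 * n = 1 := by
  rw [invSqrt, ← Complex.ofReal_pow, inv_pow, Real.sq_sqrt n.cast_nonneg, Complex.ofReal_inv,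
    Complex.ofReal_natCast, inv_mul_cancel₀ (Nat.cast_ne_zero.2 hn)]

theorem norm_invSqrt_le_one (n : ℕ) : ‖invSqrt n‖ ≤ 1 := by
  rw [invSqrt, Complex.norm_real, Real.norm_of_nonneg (by positivity)]
  rcases n.eq_zero_or_pos with rfl | hn
  · simp
  · exact inv_le_one_of_one_le₀ (Real.one_le_sqrt.2 (mod_cast hn))

theorem tendsto_invSqrt : Tendsto invSqrt atTop (𝓝 0) := by
  have h : Tendsto (fun n : ℕ => (√(n : ℝ))⁻¹) atTop (𝓝 0) :=
    tendsto_inv_atTop_zero.comp (Real.tendsto_sqrt_atTop.comp tendsto_natCast_atTop_atTop)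
  exact mod_cast (Complex.continuous_ofReal.tendsto 0).comp h

theorem permModel_one (r n : ℕ) : permModel r n 1 = invSqrt n ^ r • cycleSum r n := by
  have hfloor : ⌊(n : ℝ≥0) * 1⌋₊ = n := by rw [mul_one, Nat.floor_natCast]
  have hscale : (n : ℝ) ^ (-(r : ℝ) / 2) = (√(n : ℝ))⁻¹ ^ r := by
    rw [Real.sqrt_eq_rpow, ← Real.rpow_neg n.cast_nonneg, ← Real.rpow_mul_natCast n.cast_nonneg]
    congr 1
    ring
  rw [permModel, hscale, hfloor, invSqrt, Complex.ofReal_pow, cycleSum]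

theorem IsLabelledSum.norm_invSqrt_pow_mul_groupTrace_le {n R k : ℕ}
    {x : MonoidAlgebra ℂ finPerm} (hx : IsLabelledSum n R x) (hRk : R ≤ k) (hn : n ≠ 0) :
    ‖groupTrace (invSqrt n ^ k • x)‖ ≤ (R / 2 : ℕ) ^ R := by
  have hpow : ‖invSqrt n‖ ^ k * (n : ℝ) ^ (R / 2) ≤ 1 :=
    calc ‖invSqrt n‖ ^ k * (n : ℝ) ^ (R / 2)
        ≤ ‖invSqrt n‖ ^ (2 * (R / 2)) * (n : ℝ) ^ (R / 2) := by
          gcongr ?_ * _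
          exact pow_le_pow_of_le_one (norm_nonneg _) (norm_invSqrt_le_one n) (by omega)
      _ = ‖invSqrt n ^ 2 * n‖ ^ (R / 2) := by
          rw [norm_mul, norm_pow, Complex.norm_natCast, mul_pow, pow_mul]
      _ = 1 := by rw [invSqrt_sq_mul hn, norm_one, one_pow]
  calc ‖groupTrace (invSqrt n ^ k • x)‖
      = ‖invSqrt n‖ ^ k * ‖groupTrace x‖ := by rw [map_smul, norm_smul, norm_pow]
    _ ≤ ‖invSqrt n‖ ^ k * ((R / 2 : ℕ) ^ R * (n : ℝ) ^ (R / 2)) := by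
        gcongr
        exact hx.norm_groupTrace_le hn
    _ = (R / 2 : ℕ) ^ R * (‖invSqrt n‖ ^ k * (n : ℝ) ^ (R / 2)) := by ring
    _ ≤ (R / 2 : ℕ) ^ R := mul_le_of_le_one_right (by positivity) hpow

end Normalization

section NormalizedSums

/-- The sequences `n ↦ n^{-k/2} yₙ`, where `yₙ` is a sum of permutations labelled by `R`-tuples and
`R ≤ k`. -/
def normalizedSums : Submonoid (ℕ → MonoidAlgebra ℂ finPerm) where
  carrier := {x | ∃ R k, R ≤ k ∧ ∀ n, ∃ y, IsLabelledSum n R y ∧ x n = invSqrt n ^ k • y}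
  one_mem' := ⟨0, 0, le_rfl, fun n => ⟨1, isLabelledSum_one n, by simp⟩⟩
  mul_mem' := by
    rintro x x' ⟨R, k, hRk, hx⟩ ⟨R', k', hRk', hx'⟩
    refine ⟨R + R', k + k', add_le_add hRk hRk', fun n => ?_⟩
    obtain ⟨y, hy, hxy⟩ := hx n
    obtain ⟨y', hy', hxy'⟩ := hx' n
    exact ⟨y * y', hy.mul hy', by rw [Pi.mul_apply, hxy, hxy', smul_mul_smul_comm, pow_add]⟩

theorem smul_cycleSum_mem_normalizedSums {r k : ℕ} (hrk : r ≤ k) :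
    (fun n => invSqrt n ^ k • cycleSum r n) ∈ normalizedSums :=
  ⟨r, k, hrk, fun n => ⟨_, isLabelledSum_cycleSum r n, rfl⟩⟩

theorem smul_collisionSum_mem_normalizedSums {r : ℕ} (j : Fin r) :
    (fun n => invSqrt n ^ (r + 1) • collisionSum j n) ∈ normalizedSums :=
  ⟨r + 1, r + 1, le_rfl, fun n => ⟨_, isLabelledSum_collisionSum j n, rfl⟩⟩

/-- The algebra of sequences spanned by the normalized sums; their traces are bounded. -/
def boundedSeq : Subalgebra ℂ (ℕ → MonoidAlgebra ℂ finPerm) := Algebra.adjoin ℂ normalizedSums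

theorem normalizedSums_le_boundedSeq : normalizedSums ≤ boundedSeq.toSubmonoid :=
  Algebra.subset_adjoin

theorem isBigO_groupTrace_of_mem_normalizedSums {x : ℕ → MonoidAlgebra ℂ finPerm}
    (hx : x ∈ normalizedSums) : (fun n => groupTrace (x n)) =O[atTop] fun _ => (1 : ℝ) := by
  obtain ⟨R, k, hRk, hx⟩ := hx
  refine IsBigO.of_bound ((R / 2 : ℕ) ^ R) ((eventually_ne_atTop 0).mono fun n hn => ?_)
  obtain ⟨y, hy, hxy⟩ := hx n
  simpa [hxy] using hy.norm_invSqrt_pow_mul_groupTrace_le hRk hn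

theorem isBigO_groupTrace_of_mem_boundedSeq {x : ℕ → MonoidAlgebra ℂ finPerm}
    (hx : x ∈ boundedSeq) : (fun n => groupTrace (x n)) =O[atTop] fun _ => (1 : ℝ) := by
  rw [boundedSeq, ← Subalgebra.mem_toSubmodule, Algebra.adjoin_eq_span,
    Submonoid.closure_eq] at hx
  induction hx using Submodule.span_induction with
  | mem x hx => exact isBigO_groupTrace_of_mem_normalizedSums hx
  | zero => simpa using isBigO_zero (E' := ℂ) (fun _ : ℕ => (1 : ℝ)) atTop
  | add x y _ _ hx hy => simpa using hx.add hy
  | smul c x _ hx => simpa using hx.const_mul_left c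

/-- The ideal of the sequences of size `O(n^{-1/2})` in `boundedSeq`. -/
def vanishingIdeal : TwoSidedIdeal boundedSeq :=
  .mk' {x | ∃ y : boundedSeq, ∀ n ≠ 0, x.1 n = invSqrt n • y.1 n}
    ⟨0, by simp⟩
    (fun ⟨y, hy⟩ ⟨y', hy'⟩ => ⟨y + y', fun n hn => by simp [hy n hn, hy' n hn]⟩)
    (fun ⟨y, hy⟩ => ⟨-y, fun n hn => by simp [hy n hn]⟩)
    (fun {x _} ⟨y, hy⟩ => ⟨x * y, fun n hn => by simp [hy n hn]⟩)
    (fun {_ x} ⟨y, hy⟩ => ⟨y * x, fun n hn => by simp [hy n hn]⟩)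

theorem mem_vanishingIdeal {x : boundedSeq} :
    x ∈ vanishingIdeal ↔ ∃ y : boundedSeq, ∀ n ≠ 0, x.1 n = invSqrt n • y.1 n :=
  TwoSidedIdeal.mem_mk' ..

theorem tendsto_groupTrace_of_mem_vanishingIdeal {x : boundedSeq} (hx : x ∈ vanishingIdeal) :
    Tendsto (fun n => groupTrace (x.1 n)) atTop (𝓝 0) := by
  obtain ⟨y, hy⟩ := mem_vanishingIdeal.1 hx
  have h : Tendsto (fun n => invSqrt n * groupTrace (y.1 n)) atTop (𝓝 0) :=
    tendsto_invSqrt.zero_mul_isBoundedUnder_le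
      (isBigO_one_iff ℝ |>.1 (isBigO_groupTrace_of_mem_boundedSeq y.2))
  refine h.congr' ((eventually_ne_atTop 0).mono fun n hn => ?_)
  simp only [hy n hn, map_smul, smul_eq_mul]

end NormalizedSums

section PermModel

/-- The sequence `(M_r(n, 1))_n`. -/
def permSeq (r : ℕ) : boundedSeq :=
  ⟨fun n => permModel r n 1, by
    simp only [permModel_one]
    exact normalizedSums_le_boundedSeq (smul_cycleSum_mem_normalizedSums le_rfl)⟩

theorem permSeq_zero : permSeq 0 = 1 :=
  Subtype.ext (funext fun n => by simp [permSeq, permModel_one, cycleSum_zero])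

/-- The sequence `n^{1/2} (M_{r+1} M_1 - M_{r+2} - M_r)`. -/
def recurrenceDefect (r : ℕ) : ℕ → MonoidAlgebra ℂ finPerm := fun n =>
  invSqrt n ^ (r + 1) • (∑ j : Fin r, collisionSum j n - (r : ℂ) • cycleSum r n)

theorem recurrenceDefect_mem_boundedSeq (r : ℕ) : recurrenceDefect r ∈ boundedSeq := by
  have h : recurrenceDefect r = ∑ j : Fin r, (fun n => invSqrt n ^ (r + 1) • collisionSum j n) -
      (r : ℂ) • fun n => invSqrt n ^ (r + 1) • cycleSum r n := by
    ext1 n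
    simp only [recurrenceDefect, smul_sub, Finset.smul_sum, smul_comm (r : ℂ), Pi.sub_apply,
      Finset.sum_apply, Pi.smul_apply]
  rw [h]
  exact sub_mem
    (sum_mem fun j _ => normalizedSums_le_boundedSeq (smul_collisionSum_mem_normalizedSums j))
    (boundedSeq.smul_mem
      (normalizedSums_le_boundedSeq (smul_cycleSum_mem_normalizedSums r.le_succ)) _)

theorem permModel_succ_mul_permModel_one (r : ℕ) {n : ℕ} (hn : n ≠ 0) :
    permModel (r + 1) n 1 * permModel 1 n 1 - (permModel (r + 2) n 1 + permModel r n 1) =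
      invSqrt n • recurrenceDefect r n := by
  have hscale : invSqrt n ^ r = invSqrt n ^ (r + 2) * n := by
    rw [pow_add, mul_assoc, invSqrt_sq_mul hn, mul_one]
  simp only [permModel_one, recurrenceDefect]
  rw [smul_mul_smul_comm, cycleSum_succ_mul_cycleSum_one, hscale]
  module

theorem permSeq_succ_mul_permSeq_one_sub_mem (r : ℕ) :
    permSeq (r + 1) * permSeq 1 - (permSeq (r + 2) + permSeq r) ∈ vanishingIdeal :=
  mem_vanishingIdeal.2 ⟨⟨recurrenceDefect r, recurrenceDefect_mem_boundedSeq r⟩,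
    fun _ => permModel_succ_mul_permModel_one r⟩

theorem tendsto_groupTrace_permModel (r : ℕ) :
    Tendsto (fun n => groupTrace (permModel r n 1)) atTop (𝓝 (vacuumState (toeplitz r))) := by
  have h (n : ℕ) : groupTrace (permModel r n 1) = vacuumState (toeplitz r) := by
    rw [permModel_one, map_smul, groupTrace_cycleSum, vacuumState_toeplitz]
    split_ifs with hr <;> simp [hr]
  simpa only [h] using tendsto_const_nhds

theorem tendsto_ncDistribution_permModel (P : FreeAlgebra ℂ ℕ) :
    Tendsto (fun n => ncDistribution groupTrace (fun r => permModel r n 1) P) atTop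
      (𝓝 (ncDistribution vacuumState toeplitz P)) := by
  let eval (n : ℕ) : boundedSeq →ₐ[ℂ] MonoidAlgebra ℂ finPerm :=
    (Pi.evalAlgHom ℂ (fun _ : ℕ => MonoidAlgebra ℂ finPerm) n).comp boundedSeq.val
  have hlift (n : ℕ) : (eval n).comp (FreeAlgebra.lift ℂ permSeq) =
      FreeAlgebra.lift ℂ fun r => permModel r n 1 := by
    ext r
    simp [eval, permSeq]
  have h := tendsto_ncDistribution_of_recurrence (φ := fun n => groupTrace ∘ₗ (eval n).toLinearMap)
    (fun _ => tendsto_groupTrace_of_mem_vanishingIdeal) permSeq_zero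
    permSeq_succ_mul_permSeq_one_sub_mem toeplitz_eq_aeval_S tendsto_groupTrace_permModel P
  simp only [ncDistribution, ← hlift]
  exact h

end PermModel

end ToeplitzModel

end

open ToeplitzModel Filter Topology Polynomial in
theorem mainTheorem11_general :
    IsNCProbabilitySpace vacuumState ∧
    (∀ r : ℕ, IsSelfAdjoint (toeplitz r)) ∧
    (∀ P : FreeAlgebra ℂ ℕ,
      Tendsto (fun n => ncDistribution groupTrace (fun r => permModel r n 1) P) atTop
        (𝓝 (ncDistribution vacuumState toeplitz P))) ∧
    (∀ (A : Type*) [Ring A] [StarRing A] [Algebra ℂ A] (φ : A →ₗ[ℂ] ℂ) (x : ℕ → A),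
      IsSemicircular φ (x 1) 1 → (∀ r : ℕ, x r = aeval (x 1) (Chebyshev.S ℂ r)) →
      ncDistribution φ x = ncDistribution vacuumState toeplitz) :=
  ⟨isNCProbabilitySpace_vacuumState, isSelfAdjoint_toeplitz, tendsto_ncDistribution_permModel,
    fun _ _ _ _ _ _ h1 hx => ncDistribution_eq_of_eq_aeval_S hx toeplitz_eq_aeval_S fun r => by
      rw [hx, h1.map_aeval_S, vacuumState_toeplitz]⟩

theorem mainTheorem11 :
    -- `(𝒯, ω)` is a non-commutative probability space and the `T_r` are self-adjoint
    ToeplitzModel.IsNCProbabilitySpace ToeplitzModel.vacuumState ∧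
    (∀ r : ℕ, IsSelfAdjoint (ToeplitzModel.toeplitz r)) ∧
    -- the distribution of `(T_r)_r` is the limit distribution of the permutation model at time `1`
    (∀ P : FreeAlgebra ℂ ℕ, Filter.Tendsto
      (fun n : ℕ => ToeplitzModel.ncDistribution ToeplitzModel.groupTrace
        (fun r => ToeplitzModel.permModel r n 1) P)
      Filter.atTop
      (nhds (ToeplitzModel.ncDistribution ToeplitzModel.vacuumState ToeplitzModel.toeplitz P))) ∧
    -- it is the distribution of `(M_r(1))_r` for any realization of the limit family `(M_r(t))`
    -- by a free Brownian motion and the polynomials `U_r`, here `Polynomial.Chebyshev.S`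
    (∀ (A : Type*) [Ring A] [StarRing A] [Algebra ℂ A] [StarModule ℂ A] (φ : A →ₗ[ℂ] ℂ)
      (M : ℕ → NNReal → A),
      ToeplitzModel.IsNCProbabilitySpace φ →
      ToeplitzModel.IsFreeBrownianMotion φ (M 1) →
      (∀ (r : ℕ) (t : NNReal), 0 < t →
        M r t = (((t : ℝ) ^ ((r : ℝ) / 2) : ℝ) : ℂ) •
          Polynomial.aeval ((((t : ℝ) ^ (-(1 : ℝ) / 2) : ℝ) : ℂ) • M 1 t)
            (Polynomial.Chebyshev.S ℂ r)) →
      ToeplitzModel.ncDistribution φ (fun r => M r 1) =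
        ToeplitzModel.ncDistribution ToeplitzModel.vacuumState ToeplitzModel.toeplitz) := by
  obtain ⟨hω, hT, hperm, hsemi⟩ := mainTheorem11_general
  exact ⟨hω, hT, hperm, fun A _ _ _ _ φ M _ hM hS =>
    hsemi A φ (fun r => M r 1) (hM.semicircular 1) fun r => by simpa using hS r 1 one_pos⟩
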